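/- Let $\mathcal C$ be a class of finite groups, invariant under isomorphism, which is full, i.e. closed under subgroups, quotients and group extensions. A pro-$\mathcal C$ group is an inverse limit of a surjective inverse system of (discrete) groups in $\mathcal C$. For a profinite group $G$ and a finite subset $\Gamma \subseteq G$, the Cayley graph $G_\Gamma$ has vertex set $G$, with $g$ joined to $gs$ for $g \in G$, $s \in \Gamma$; it is the union of the Cayley graph of the abstract subgroup $\langle \Gamma\rangle$ and of its left translates, which are its connected components, and it carries the word metric (the graph distance $d$, finite exactly within a component). A pro-$\mathcal C$ group $G$ is called hyperbolic if there are a finite subset $\Gamma$ with $\overline{\langle\Gamma\rangle}=G$ and a $\delta\ge 0$ such that every component of $G_\Gamma$ is $\delta$-hyperbolic, i.e. such that $$(x.y)_{x_0} \ge \min\big((x.z)_{x_0},(y.z)_{x_0}\big)-\delta,\qquad (x.y)_{x_0}=\tfrac12\big(d(x,x_0)+d(y,x_0)-d(x,y)\big),$$ for all vertices $x_0,x,y,z$ in the same component. A family of continuous homomorphisms $\varphi_i : G_i\to K$ $(i\in I)$ of pro-$\mathcal C$ groups is convergent to $1$ if every open neighbourhood of $1$ in $K$ contains $\varphi_i(G_i)$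 for all but finitely many $i$ (this is automatic for finite $I$). A free pro-$\mathcal C$ product of a family $(G_i)_{i\in I}$ of pro-$\mathcal C$ groups is a pro-$\mathcal C$ group $H$ with a family of continuous homomorphisms $\rho_i : G_i \to H$ convergent to $1$, such that for every pro-$\mathcal C$ group $K$ and every family of continuous homomorphisms $\varphi_i : G_i\to K$ convergent to $1$ there is a unique continuous homomorphism $\psi : H\to K$ with $\psi\circ\rho_i=\varphi_i$ for all $i$. **Proposition.** Let $I$ be a finite set, let $G_i$ $(i \in I)$ be hyperbolic pro-$\mathcal C$ groups, and let $H$ be a free pro-$\mathcal C$ product of the $G_i$. Then $H$ is a hyperbolic pro-$\mathcal C$ group. -/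

import Mathlib

open Topology

universe u v

/-- A class of finite groups: a predicate on groups which is invariant under isomorphism and which
holds only for finite groups. -/
structure FiniteGroupClass where
  /-- Membership in the class. -/
  Mem : ∀ (Q : Type u) [Group Q], Prop
  finite_of_mem : ∀ (Q : Type u) [Group Q], Mem Q → Finite Q
  mem_of_mulEquiv : ∀ (Q R : Type u) [Group Q] [Group R], Q ≃* R → Mem Q → Mem R

/-- A class of finite groups is full if it is closed under subgroups, quotients and group
extensions. -/
structure FiniteGroupClass.IsFull (C : FiniteGroupClass.{u}) : Prop where
  subgroup : ∀ (Q : Type u) [Group Q] (S : Subgroup Q), C.Mem Q → C.Mem S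
  quotient : ∀ (Q : Type u) [Group Q] (N : Subgroup Q) [N.Normal], C.Mem Q → C.Mem (Q ⧸ N)
  extension : ∀ (Q : Type u) [Group Q] (N : Subgroup Q) [N.Normal],
    C.Mem N → C.Mem (Q ⧸ N) → C.Mem Q

/-- A topological group is pro-`C` if it is an inverse limit of a surjective inverse system of
discrete groups in `C`: it is compact, Hausdorff and totally disconnected, and the open normal
subgroups with quotient in `C` form a basis of neighbourhoods of the identity (so that the group is
the inverse limit of these quotients). -/
structure IsProC (C : FiniteGroupClass.{u}) (G : Type u) [Group G] [TopologicalSpace G]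
    [IsTopologicalGroup G] : Prop where
  compactSpace : CompactSpace G
  t2Space : T2Space G
  totallyDisconnectedSpace : TotallyDisconnectedSpace G
  exists_openNormalSubgroup : ∀ U ∈ 𝓝 (1 : G), ∃ N : OpenNormalSubgroup G,
    (N : Set G) ⊆ U ∧ C.Mem (G ⧸ N.toSubgroup)

/-- A family of homomorphisms into `H` is convergent to `1` if every open neighbourhood of `1`
contains almost all of the images. -/
def ConvergentToOne {ι : Type v} {G : ι → Type u} [∀ i, Group (G i)]
    [∀ i, TopologicalSpace (G i)] {H : Type u} [Group H] [TopologicalSpace H]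
    (ρ : ∀ i, G i →ₜ* H) : Prop :=
  ∀ U : Set H, IsOpen U → (1 : H) ∈ U → {i | ¬ Set.range (ρ i) ⊆ U}.Finite

/-- `H`, together with the homomorphisms `ρ i : G i → H`, is a free pro-`C` product of the family
`G`: it is a pro-`C` group, `ρ` is convergent to `1`, and `ρ` is universal among all families of
continuous homomorphisms to a pro-`C` group that are convergent to `1`. -/
structure IsFreeProCProduct (C : FiniteGroupClass.{u}) {ι : Type v} {G : ι → Type u}
    [∀ i, Group (G i)] [∀ i, TopologicalSpace (G i)] {H : Type u} [Group H] [TopologicalSpace H]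
    [IsTopologicalGroup H] (ρ : ∀ i, G i →ₜ* H) : Prop where
  isProC : IsProC C H
  convergentToOne : ConvergentToOne ρ
  existsUnique_lift : ∀ (K : Type u) [Group K] [TopologicalSpace K] [IsTopologicalGroup K],
    IsProC C K → ∀ φ : ∀ i, G i →ₜ* K, ConvergentToOne φ →
      ∃! ψ : H →ₜ* K, ∀ i, ψ.comp (ρ i) = φ i

/-- The Gromov product of `x` and `y` with respect to the base point `x₀`, for the distance
function `d`. -/
noncomputable def gromovProduct {X : Type u} (d : X → X → ℝ) (x₀ x y : X) : ℝ :=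
  (d x x₀ + d y x₀ - d x y) / 2

/-- The set `S`, with the distance function `d`, is `δ`-hyperbolic. -/
def IsDeltaHyperbolicOn {X : Type u} (d : X → X → ℝ) (S : Set X) (δ : ℝ) : Prop :=
  ∀ x₀ ∈ S, ∀ x ∈ S, ∀ y ∈ S, ∀ z ∈ S,
    min (gromovProduct d x₀ x z) (gromovProduct d x₀ y z) - δ ≤ gromovProduct d x₀ x y

/-- The Cayley graph of `G` with respect to `Γ` is Gromov hyperbolic for the word metric.
The Cayley graph has vertex set `G` and edges joining `g` to `g * s` for `s ∈ Γ`. It is the union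
of the Cayley graph of the abstract subgroup generated by `Γ` and of its left translates, which are
the connected components of the graph. The word metric is the graph distance; it is finite exactly
inside a connected component, and all components are required to be `δ`-hyperbolic for a common
`δ ≥ 0`. -/
def HasHyperbolicCayleyGraph (G : Type u) [Group G] (Γ : Set G) : Prop :=
  ∃ δ : ℝ, 0 ≤ δ ∧ ∀ c : (SimpleGraph.mulCayley Γ).ConnectedComponent,
    IsDeltaHyperbolicOn (fun x y => ((SimpleGraph.mulCayley Γ).dist x y : ℝ)) c.supp δ

/-- A hyperbolic pro-`C` group: a pro-`C` group that has a finite topological generating set whose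
Cayley graph, with the word metric, is Gromov hyperbolic. -/
def IsHyperbolicProC (C : FiniteGroupClass.{u}) (G : Type u) [Group G] [TopologicalSpace G]
    [IsTopologicalGroup G] : Prop :=
  IsProC C G ∧ ∃ Γ : Set G, Γ.Finite ∧ (Subgroup.closure Γ).topologicalClosure = ⊤ ∧
    HasHyperbolicCayleyGraph G Γ

/-! Take Γ to be the union of the images of the generating sets Γᵢ. It generates H topologically,
because a closed subgroup containing every factor has the lifting property and is therefore all of H
(`eq_top_of_isClosed`). Hyperbolicity concerns only the abstract subgroup ⟨Γ⟩, and the point is that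
⟨Γ⟩ is the abstract free product of the groups ⟨Γᵢ⟩ with the expected word length.

Freeness (`prod_map_ne_one`): given a reduced word, choose a finite quotient P of H in C in which no
letter dies, and a prime p dividing |P|. Every finite p-group T lies in C, hence so does the wreath
product of T by P. Map the i-th factor through P and conjugate by a base element t(i, ·). The base
component of the image of the word, evaluated at 1, is a product of letters t(i, q)^±1 in which
neighbouring letters differ; unitriangular matrices over `ZMod p` supply T and t making it
nontrivial.

Geometry: in a free product the length of a reduced word is the sum of the lengths of its letters,
so the Gromov product of two words is the length of their common prefix plus, if the next letters
lie in one factor, the Gromov product of those two letters (`two_mul_listGromov`). The four-point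
inequality then reduces to a single factor, and the largest of the finitely many δᵢ suffices
(`min_listGromov_sub_le`). -/

/-! ### Finite `p`-groups in full classes -/

/-- By Cauchy, Q contains a cyclic group of order p. A nontrivial finite p-group has a central
subgroup of order p, so T is built by successive extensions. -/
theorem FiniteGroupClass.IsFull.mem_of_isPGroup {C : FiniteGroupClass.{u}} (hC : C.IsFull)
    {Q : Type u} [Group Q] (hQ : C.Mem Q) {p : ℕ} [hp : Fact p.Prime] (hpQ : p ∣ Nat.card Q)
    {T : Type u} [Group T] [Finite T] (hT : IsPGroup p T) : C.Mem T := by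
  have := C.finite_of_mem Q hQ
  obtain ⟨x, hx⟩ := exists_prime_orderOf_dvd_card' p hpQ
  generalize hn : Nat.card T = n
  induction n using Nat.strong_induction_on generalizing T with
  | _ n ih =>
  rcases subsingleton_or_nontrivial T with hs | hs
  · have : Unique T := ⟨⟨1⟩, fun _ => Subsingleton.elim _ _⟩
    exact C.mem_of_mulEquiv _ _ (MulEquiv.ofUnique (M := (⊥ : Subgroup Q)) (N := T))
      (hC.subgroup Q ⊥ hQ)
  · have := hT.center_nontrivial
    have hd : p ∣ Nat.card (Subgroup.center T) := by
      obtain ⟨k, hk⟩ := (hT.to_subgroup (Subgroup.center T)).exists_card_eq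
      rw [hk]
      refine dvd_pow_self p ?_
      rintro rfl
      have := Finite.one_lt_card (α := Subgroup.center T)
      simp only [pow_zero] at hk
      omega
    obtain ⟨z, hz⟩ := exists_prime_orderOf_dvd_card' p hd
    have hz' : orderOf (z : T) = p := by rw [Subgroup.orderOf_coe, hz]
    have hN : (Subgroup.zpowers (z : T)).Normal := by
      refine ⟨fun n hn g => ?_⟩
      have hc : n ∈ Subgroup.center T :=
        (Subgroup.zpowers_le.mpr z.2 : Subgroup.zpowers (z : T) ≤ _) hn
      rw [(Subgroup.mem_center_iff.mp hc g), mul_assoc, mul_inv_cancel, mul_one]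
      exact hn
    have hcN : Nat.card (Subgroup.zpowers (z : T)) = p := by rw [Nat.card_zpowers, hz']
    refine hC.extension T (Subgroup.zpowers (z : T)) ?_ ?_
    · refine C.mem_of_mulEquiv _ _ (mulEquivOfPrimeCardEq (p := p) ?_ ?_)
        (hC.subgroup Q (Subgroup.zpowers x) hQ)
      · rw [Nat.card_zpowers, hx]
      · exact hcN
    · refine ih _ ?_ (hT.to_quotient _) rfl
      have h1 := Subgroup.card_eq_card_quotient_mul_card_subgroup (Subgroup.zpowers (z : T))
      rw [hcN] at h1
      have h2 := hp.out.two_le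
      have h3 : 0 < Nat.card (T ⧸ Subgroup.zpowers (z : T)) := Nat.card_pos
      rw [← hn, h1]
      nlinarith

/-! ### Unitriangular matrices over `ZMod p` -/

/-- The matrices whose entries below the `k`-th superdiagonal vanish. -/
def Matrix.IsSuperdiagonal {R : Type*} [Zero R] {n : ℕ} (k : ℕ) (A : Matrix (Fin n) (Fin n) R) :
    Prop :=
  ∀ i j : Fin n, (j : ℕ) < i + k → A i j = 0

theorem Matrix.IsSuperdiagonal.mul {R : Type*} [Ring R] {n k l : ℕ}
    {A B : Matrix (Fin n) (Fin n) R} (hA : A.IsSuperdiagonal k) (hB : B.IsSuperdiagonal l) :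
    (A * B).IsSuperdiagonal (k + l) := by
  intro i j hij
  rw [Matrix.mul_apply]
  refine Finset.sum_eq_zero fun m _ => ?_
  by_cases h : (m : ℕ) < i + k
  · rw [hA i m h, zero_mul]
  · rw [hB m j (by omega), mul_zero]

theorem Matrix.IsSuperdiagonal.pow {R : Type*} [Ring R] {n : ℕ}
    {A : Matrix (Fin n) (Fin n) R} (hA : A.IsSuperdiagonal 1) (k : ℕ) :
    (A ^ k).IsSuperdiagonal k := by
  induction k with
  | zero =>
    intro i j hij
    rw [pow_zero, Matrix.one_apply_ne]
    rintro rfl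
    simp at hij
  | succ k ih => rw [pow_succ]; exact ih.mul hA

/-- The group of upper unitriangular matrices. -/
def unitriangularGroup (R : Type*) [Ring R] (n : ℕ) : Subgroup (Matrix (Fin n) (Fin n) R)ˣ where
  carrier := {u | Matrix.IsSuperdiagonal 1 (u.val - 1) ∧ Matrix.IsSuperdiagonal 1 (u⁻¹.val - 1)}
  one_mem' := by simp [Matrix.IsSuperdiagonal]
  inv_mem' := by
    rintro u ⟨h1, h2⟩
    exact ⟨h2, by simpa using h1⟩
  mul_mem' := by
    have key : ∀ A B : Matrix (Fin n) (Fin n) R, Matrix.IsSuperdiagonal 1 (A - 1) →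
        Matrix.IsSuperdiagonal 1 (B - 1) → Matrix.IsSuperdiagonal 1 (A * B - 1) := by
      intro A B hA hB i j hij
      have h : A * B - 1 = (A - 1) * (B - 1) + (A - 1) + (B - 1) := by noncomm_ring
      rw [h, Matrix.add_apply, Matrix.add_apply, hA i j hij, hB i j hij,
        hA.mul hB i j (by omega)]
      simp
    rintro u w ⟨h1, h2⟩ ⟨h3, h4⟩
    exact ⟨by simpa using key _ _ h1 h3, by
      rw [mul_inv_rev, Units.val_mul]; exact key _ _ h4 h2⟩

/-- In characteristic p, (1 + A)^(p^m) = 1 + A^(p^m), and a strictly upper triangular A is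
nilpotent. -/
theorem isPGroup_unitriangularGroup (p : ℕ) [hp : Fact p.Prime] (n : ℕ) :
    IsPGroup p (unitriangularGroup (ZMod p) n) := by
  -- Matrices of size zero form the zero ring, which does not have characteristic p.
  rcases n with _ | n
  · intro u
    exact ⟨0, Subsingleton.elim _ _⟩
  intro u
  have hu := u.2.1
  refine ⟨n + 1, Subtype.ext (Units.ext ?_)⟩
  have h1 : u.1.val = (u.1.val - 1) + 1 := by simp
  rw [SubmonoidClass.coe_pow, Units.val_pow_eq_pow_val, OneMemClass.coe_one, Units.val_one, h1, add_pow_char_pow_of_commute p _ (Commute.one_right _), one_pow,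
    add_eq_right]
  ext i j
  refine hu.pow _ i j ?_
  have := Nat.lt_pow_self (n := n + 1) hp.out.one_lt
  omega

/-- The matrix with a one at the superdiagonal positions `(k, k + 1)` where the `k`-th letter of `y`
is `a`. -/
def letterMatrix {Y : Type*} [DecidableEq Y] (R : Type*) [Ring R] {n : ℕ} (y : Fin n → Y) (a : Y) :
    Matrix (Fin (n + 1)) (Fin (n + 1)) R :=
  fun i j => if ∃ k : Fin n, y k = a ∧ i = k.castSucc ∧ j = k.succ then 1 else 0

theorem letterMatrix_isSuperdiagonal {Y : Type*} [DecidableEq Y] (R : Type*) [Ring R] {n : ℕ}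
    (y : Fin n → Y) (a : Y) : (letterMatrix R y a).IsSuperdiagonal 1 := by
  intro i j hij
  rw [letterMatrix, if_neg]
  rintro ⟨k, -, rfl, rfl⟩
  simp at hij

/-- A nonzero term in the product would need the letter a at two consecutive positions. Hence 1 + A
has inverse 1 - A. -/
theorem letterMatrix_mul_self {Y : Type*} [DecidableEq Y] (R : Type*) [Ring R] {n : ℕ}
    (y : Fin n → Y) (hy : ∀ k l : Fin n, (l : ℕ) = k + 1 → y k ≠ y l) (a : Y) :
    letterMatrix R y a * letterMatrix R y a = 0 := by
  ext i j
  rw [Matrix.mul_apply]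
  refine Finset.sum_eq_zero fun m _ => ?_
  simp only [letterMatrix]
  split_ifs with h1 h2 <;> try simp
  obtain ⟨k, hk, -, rfl⟩ := h1
  obtain ⟨l, hl, h, -⟩ := h2
  refine (hy k l ?_ (hk.trans hl.symm)).elim
  simpa using (congrArg Fin.val h).symm

/-- The unipotent element attached to the letter `a`. -/
def letterUnit {Y : Type*} [DecidableEq Y] (R : Type*) [Ring R] {n : ℕ}
    (y : Fin n → Y) (hy : ∀ k l : Fin n, (l : ℕ) = k + 1 → y k ≠ y l) (a : Y) :
    unitriangularGroup R (n + 1) :=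
  ⟨{ val := 1 + letterMatrix R y a
     inv := 1 - letterMatrix R y a
     val_inv := by
      have := letterMatrix_mul_self R y hy a
      have h : (1 + letterMatrix R y a) * (1 - letterMatrix R y a)
        = 1 - letterMatrix R y a * letterMatrix R y a := by noncomm_ring
      rw [h, this, sub_zero]
     inv_val := by
      have := letterMatrix_mul_self R y hy a
      have h : (1 - letterMatrix R y a) * (1 + letterMatrix R y a)
        = 1 - letterMatrix R y a * letterMatrix R y a := by noncomm_ring
      rw [h, this, sub_zero] }, by
    refine ⟨?_, ?_⟩
    · simpa using letterMatrix_isSuperdiagonal R y a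
    · intro i j hij
      simp [letterMatrix_isSuperdiagonal R y a i j hij]⟩

/-- The value of the signed letter `a` in a group. -/
def signedLetter {Y : Type*} {T : Type*} [Group T] (t : Y → T) (a : Y × Bool) : T :=
  bif a.2 then t a.1 else (t a.1)⁻¹

theorem signedLetter_letterUnit {Y : Type*} [DecidableEq Y] (R : Type*) [Ring R] {n : ℕ}
    (y : Fin n → Y) (hy : ∀ k l : Fin n, (l : ℕ) = k + 1 → y k ≠ y l) (a : Y × Bool) :
    ((signedLetter (letterUnit R y hy) a).1.val : Matrix _ _ R) =
      1 + (bif a.2 then (1 : R) else -1) • letterMatrix R y a.1 := by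
  rcases a with ⟨a, _ | _⟩
  · simp only [signedLetter, cond_false, InvMemClass.coe_inv, letterUnit, neg_smul, one_smul,
      ← sub_eq_add_neg]
    rfl
  · simp [signedLetter, letterUnit]

/-- Each further letter pushes the last nonzero entry of the top row one column to the right,
changing it only by a sign. For the whole word the top right entry is thus a unit. -/
theorem prod_take_signedLetter {Y : Type*} [DecidableEq Y] (R : Type*) [CommRing R]
    (L : List (Y × Bool))
    (hy : ∀ k l : Fin L.length, (l : ℕ) = k + 1 → (L.get k).1 ≠ (L.get l).1)
    (k : ℕ) (hk : k ≤ L.length) :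
    let P := ((L.take k).map (signedLetter (letterUnit R (fun k => (L.get k).1) hy))).prod.1.val
    (∀ l : Fin (L.length + 1), k < l → P 0 l = 0) ∧
      IsUnit (P 0 ⟨k, Nat.lt_succ_of_le hk⟩) := by
  induction k with
  | zero =>
    refine ⟨fun l hl => ?_, ?_⟩
    · have : (0 : Fin (L.length + 1)) ≠ l := by
        rintro rfl; simp at hl
      simp [this]
    · simp
  | succ k ih =>
    obtain ⟨ih1, ih2⟩ := ih (by omega)
    have hk' : k < L.length := hk
    simp only [List.take_succ_eq_append_getElem hk', List.map_append, List.prod_append,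
      List.map_cons, List.map_nil, List.prod_singleton, Subgroup.coe_mul, Units.val_mul,
      signedLetter_letterUnit, mul_add, mul_one, Matrix.add_apply, Matrix.mul_smul,
      Matrix.smul_apply]
    set P := ((L.take k).map (signedLetter (letterUnit R (fun k => (L.get k).1) hy))).prod.1.val
    -- Column l + 1 of a letter matrix can be nonzero only in row l, so the sum has one term.
    have key : ∀ l : Fin L.length, k ≤ l →
        (P * letterMatrix R (fun k => (L.get k).1) (L[k]).1) 0 l.succ =
          if (l : ℕ) = k then P 0 ⟨k, by omega⟩ else 0 := by
      intro l hl
      rw [Matrix.mul_apply, Finset.sum_eq_single l.castSucc]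
      · split_ifs with h
        · have : l = ⟨k, hk'⟩ := Fin.ext h
          subst this
          have : letterMatrix R (fun k => (L.get k).1) (L[k]).1
              (Fin.castSucc ⟨k, hk'⟩) (Fin.succ ⟨k, hk'⟩) = 1 := by
            rw [letterMatrix, if_pos]
            exact ⟨⟨k, hk'⟩, rfl, rfl, rfl⟩
          rw [this, mul_one]
          rfl
        · rw [ih1 _ (by simp; omega), zero_mul]
      · intro m _ hm
        rw [letterMatrix, if_neg, mul_zero]
        rintro ⟨j, -, rfl, h2⟩
        exact hm (by rw [Fin.succ_inj.mp h2])
      · simp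
    refine ⟨fun l hl => ?_, ?_⟩
    · obtain ⟨m, rfl⟩ := Fin.exists_succ_eq.mpr (show l ≠ 0 by rintro rfl; simp at hl)
      simp only [Fin.val_succ, add_lt_add_iff_right] at hl
      rw [ih1 _ (by simp; omega), key m hl.le, if_neg hl.ne']
      simp
    · have h0 := key ⟨k, hk'⟩ le_rfl
      simp only [Fin.succ_mk, if_true] at h0
      rw [ih1 _ (by simp), h0, zero_add]
      cases (L[k]).2
      · simpa using ih2
      · simpa using ih2

/-- Free groups are residually `p`, for words in which adjacent letters are different. -/
theorem exists_isPGroup_prod_ne_one {Y : Type*} (p : ℕ) [hp : Fact p.Prime] (L : List (Y × Bool))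
    (hL : L ≠ []) (hc : L.IsChain (fun a b => a.1 ≠ b.1)) :
    ∃ (T : Type u) (_ : Group T) (_ : Finite T) (t : Y → T), IsPGroup p T ∧
      (L.map (signedLetter t)).prod ≠ 1 := by
  classical
  have hy : ∀ k l : Fin L.length, (l : ℕ) = k + 1 → (L.get k).1 ≠ (L.get l).1 := by
    rintro ⟨k, hk⟩ ⟨l, hl⟩ rfl
    exact List.isChain_iff_getElem.mp hc k hl
  let S := unitriangularGroup (ZMod p) (L.length + 1)
  have : Fintype (ZMod p) := ZMod.fintype p
  -- `ULift` only moves the group to the universe of C.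
  refine ⟨ULift.{u} S, inferInstance, inferInstance,
    fun a => ⟨letterUnit (ZMod p) _ hy a⟩,
    (isPGroup_unitriangularGroup p _).of_equiv MulEquiv.ulift.symm, fun h => ?_⟩
  have h' := congrArg (MulEquiv.ulift : ULift.{u} S ≃* S) h
  rw [map_list_prod, List.map_map, map_one] at h'
  have h2 := (prod_take_signedLetter (ZMod p) L hy L.length le_rfl).2
  have h3 : (MulEquiv.ulift : ULift.{u} S ≃* S) ∘
      signedLetter (fun a => (⟨letterUnit (ZMod p) _ hy a⟩ : ULift.{u} S)) =
      signedLetter (letterUnit (ZMod p) _ hy) := by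
    funext a
    rcases a with ⟨a, _ | _⟩ <;> rfl
  rw [h3] at h'
  rw [List.take_length, h'] at h2
  have : (0 : Fin (L.length + 1)) ≠ ⟨L.length, by omega⟩ := by
    intro h
    have := congrArg Fin.val h
    simp only [Fin.val_zero] at this
    exact hL (List.length_eq_zero_iff.mp this.symm)
  simp [this] at h2

/-! ### Wreath products -/

/-- The kernel of the projection to Q embeds in the p-group of functions Q → T, so the wreath
product is an extension of members of C. -/
theorem FiniteGroupClass.IsFull.mem_regularWreathProduct {C : FiniteGroupClass.{u}}
    (hC : C.IsFull) {Q : Type u} [Group Q] (hQ : C.Mem Q) {p : ℕ} [hp : Fact p.Prime]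
    (hpQ : p ∣ Nat.card Q) {T : Type u} [Group T] [Finite T] (hT : IsPGroup p T) :
    C.Mem (RegularWreathProduct T Q) := by
  have := C.finite_of_mem Q hQ
  refine hC.extension _ (RegularWreathProduct.rightHom (D := T) (Q := Q)).ker ?_ ?_
  · have hK : IsPGroup p (RegularWreathProduct.rightHom (D := T) (Q := Q)).ker := by
      obtain ⟨n, hn⟩ := hT.exists_card_eq
      have hpi : IsPGroup p (Q → T) := by
        intro f
        refine ⟨n, funext fun q => ?_⟩
        rw [Pi.pow_apply, ← hn, pow_card_eq_one', Pi.one_apply]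
      let f : (RegularWreathProduct.rightHom (D := T) (Q := Q)).ker →* (Q → T) :=
        { toFun := fun x => x.1.left
          map_one' := rfl
          map_mul' := by
            rintro ⟨x, hx⟩ ⟨y, hy⟩
            have hx' : x.right = 1 := hx
            funext q
            simp [hx'] }
      refine hpi.of_injective f ?_
      rintro ⟨x, hx⟩ ⟨y, hy⟩ hxy
      have hx' : x.right = 1 := hx
      have hy' : y.right = 1 := hy
      exact Subtype.ext (RegularWreathProduct.ext hxy (hx'.trans hy'.symm))
    exact hC.mem_of_isPGroup hQ hpQ hK
  · exact C.mem_of_mulEquiv _ _ (QuotientGroup.quotientKerEquivOfSurjective _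
      (fun q => ⟨RegularWreathProduct.inl q, rfl⟩)).symm hQ

/-! ### Pro-`C` groups -/

theorem isProC_of_discreteTopology {C : FiniteGroupClass.{u}} {K : Type u} [Group K]
    [TopologicalSpace K] [IsTopologicalGroup K] [DiscreteTopology K] (hK : C.Mem K) :
    IsProC C K := by
  have := C.finite_of_mem K hK
  refine ⟨inferInstance, inferInstance, inferInstance, fun U hU => ?_⟩
  refine ⟨⟨⟨⊥, isOpen_discrete _⟩, inferInstanceAs (⊥ : Subgroup K).Normal⟩, ?_, ?_⟩
  · intro x hx
    have : x = 1 := hx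
    rw [this]
    exact mem_of_mem_nhds hU
  · exact C.mem_of_mulEquiv _ _ (QuotientGroup.quotientBot (G := K)).symm hK

theorem IsProC.of_isClosed {C : FiniteGroupClass.{u}} (hC : C.IsFull) {H : Type u} [Group H]
    [TopologicalSpace H] [IsTopologicalGroup H] (hH : IsProC C H) (L : Subgroup H)
    (hL : IsClosed (L : Set H)) : IsProC C L := by
  have := hH.compactSpace
  have := hH.t2Space
  have := hH.totallyDisconnectedSpace
  refine ⟨isCompact_iff_compactSpace.mp hL.isCompact, inferInstance, inferInstance,
    fun U hU => ?_⟩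
  rw [nhds_subtype, Filter.mem_comap] at hU
  obtain ⟨V, hV, hVU⟩ := hU
  obtain ⟨N, hNV, hN⟩ := hH.exists_openNormalSubgroup V hV
  have : N.toSubgroup.Normal := N.isNormal'
  refine ⟨⟨⟨N.toSubgroup.subgroupOf L, N.isOpen'.preimage continuous_subtype_val⟩,
    Subgroup.normal_subgroupOf⟩, fun x hx => hVU (hNV hx), ?_⟩
  let f : L →* H ⧸ N.toSubgroup := (QuotientGroup.mk' N.toSubgroup).comp L.subtype
  have hf : f.ker = N.toSubgroup.subgroupOf L := by
    ext x
    simp [f, MonoidHom.mem_ker, Subgroup.mem_subgroupOf]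
  exact C.mem_of_mulEquiv _ _ ((QuotientGroup.quotientKerEquivRange f).symm.trans
    (QuotientGroup.quotientMulEquivOfEq hf)) (hC.subgroup _ f.range hN)

/-! ### Free pro-C products: generation, embedded factors, reduced words -/

section FreeProduct

variable {C : FiniteGroupClass.{u}} {ι : Type v} [Finite ι] {G : ι → Type u}
  [∀ i, Group (G i)] [∀ i, TopologicalSpace (G i)] {H : Type u} [Group H] [TopologicalSpace H]
  [IsTopologicalGroup H] {ρ : ∀ i, G i →ₜ* H}

theorem ConvergentToOne.of_finite {K : Type u} [Group K] [TopologicalSpace K]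
    (φ : ∀ i, G i →ₜ* K) : ConvergentToOne φ :=
  fun _ _ _ => Set.toFinite _

/-- Lift the corestrictions G i → L to H → L. Composed with the inclusion of L this fixes every `ρ
i`, so by uniqueness it is the identity of H. -/
theorem IsFreeProCProduct.eq_top_of_isClosed (hC : C.IsFull) (hρ : IsFreeProCProduct C ρ)
    (L : Subgroup H) (hL : IsClosed (L : Set H)) (h : ∀ i x, ρ i x ∈ L) : L = ⊤ := by
  let φ : ∀ i, G i →ₜ* L := fun i =>
    ⟨(ρ i).toMonoidHom.codRestrict L (h i), (ρ i).continuous_toFun.subtype_mk _⟩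
  obtain ⟨ψ, hψ, -⟩ := hρ.existsUnique_lift L (hρ.isProC.of_isClosed hC L hL) φ
    (ConvergentToOne.of_finite φ)
  obtain ⟨θ, -, hθ⟩ := hρ.existsUnique_lift H hρ.isProC ρ hρ.convergentToOne
  let j : L →ₜ* H := ⟨L.subtype, continuous_subtype_val⟩
  have h1 : j.comp ψ = θ := hθ _ fun i => by
    ext x
    exact congrArg (fun f : G i →ₜ* L => (f x : H)) (hψ i)
  have h2 : ContinuousMonoidHom.id H = θ := hθ _ fun i => by ext x; rfl
  refine eq_top_iff.mpr fun x _ => ?_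
  have h3 : j.comp ψ = ContinuousMonoidHom.id H := h1.trans h2.symm
  have h4 : (ψ x : H) = x := congrArg (fun f : H →ₜ* H => f x) h3
  rw [← h4]
  exact (ψ x).2

/-- The identity on the factor i and trivial maps on the others lift to a retraction of H onto G i.
-/
theorem IsFreeProCProduct.injective [∀ i, IsTopologicalGroup (G i)]
    (hρ : IsFreeProCProduct C ρ) (i : ι) (hi : IsProC C (G i)) :
    Function.Injective (ρ i) := by
  classical
  let φ : ∀ j, G j →ₜ* G i := fun j =>
    if h : j = i then h ▸ ContinuousMonoidHom.id (G j) else 1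
  obtain ⟨ψ, hψ, -⟩ := hρ.existsUnique_lift (G i) hi φ (ConvergentToOne.of_finite φ)
  have h1 : φ i = ContinuousMonoidHom.id (G i) := by simp [φ]
  have h2 : ∀ x, ψ (ρ i x) = x := fun x =>
    (congrArg (fun f : G i →ₜ* G i => f x) (hψ i)).trans
      (congrArg (fun f : G i →ₜ* G i => f x) h1)
  exact Function.LeftInverse.injective h2

/-- The word in the letters `ι × P` which describes the base component of the image of a word in the
free product under the conjugated diagonal embeddings into the wreath product. -/
def wreathWord {P : Type u} [Group P] (π : ∀ i, G i → P) : List (Σ i, G i) → P →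
    List ((ι × P) × Bool)
  | [], _ => []
  | ⟨i, g⟩ :: l, x => ((i, x), true) :: ((i, (π i g)⁻¹ * x), false) ::
      wreathWord π l ((π i g)⁻¹ * x)

omit [Finite ι] [∀ i, Group (G i)] [∀ i, TopologicalSpace (G i)] in
-- The two letters coming from one syllable differ in P since that syllable survives in P; letters
-- from neighbouring syllables differ in the index.
theorem wreathWord_isChain {P : Type u} [Group P] (π : ∀ i, G i → P) (l : List (Σ i, G i))
    (hl : l.IsChain (fun a b => a.1 ≠ b.1)) (hπ : ∀ a ∈ l, π a.1 a.2 ≠ 1) (x : P) :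
    (wreathWord π l x).IsChain (fun a b => a.1 ≠ b.1) := by
  induction l generalizing x with
  | nil => exact List.isChain_nil
  | cons a l ih =>
    obtain ⟨i, g⟩ := a
    have hg : π i g ≠ 1 := hπ ⟨i, g⟩ (by simp)
    have ih' := ih hl.tail (fun a ha => hπ a (by simp [ha])) ((π i g)⁻¹ * x)
    rw [wreathWord, List.isChain_cons_cons]
    refine ⟨by simpa [Prod.ext_iff] using hg, ?_⟩
    rcases l with _ | ⟨⟨k, m⟩, l⟩
    · simp [wreathWord]
    · rw [wreathWord] at ih' ⊢
      refine List.isChain_cons_cons.mpr ⟨?_, ih'⟩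
      have := (List.isChain_cons_cons.mp hl).1
      simp [this]

omit [Finite ι] [∀ i, TopologicalSpace (G i)] in
-- Conjugating q ∈ P by the base function f gives the base component x ↦ f(x) f(q⁻¹x)⁻¹; the factors
-- after it are then evaluated at q⁻¹x.
theorem left_prod_wreath {P T : Type u} [Group P] [Group T] (π : ∀ i, G i →* P)
    (t : ι × P → T) (l : List (Σ i, G i)) (x : P) :
    (l.map fun a => MulAut.conj (⟨fun q => t (a.1, q), 1⟩ : RegularWreathProduct T P)
      (RegularWreathProduct.inl (π a.1 a.2))).prod.left x =
      ((wreathWord (fun i => π i) l x).map (signedLetter t)).prod := by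
  induction l generalizing x with
  | nil => rfl
  | cons a l ih =>
    rw [List.map_cons, List.prod_cons, RegularWreathProduct.mul_left, Pi.mul_apply]
    simp only [wreathWord, List.map_cons, List.prod_cons, ← ih, ← mul_assoc]
    congr 1
    · simp [signedLetter]
    · simp

theorem IsFreeProCProduct.prod_map_ne_one [∀ i, IsTopologicalGroup (G i)] (hC : C.IsFull)
    (hG : ∀ i, IsProC C (G i)) (hρ : IsFreeProCProduct C ρ) (l : List (Σ i, G i)) (hne : l ≠ [])
    (hl : l.IsChain (fun a b => a.1 ≠ b.1)) (h1 : ∀ a ∈ l, a.2 ≠ 1) :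
    (l.map fun a => ρ a.1 a.2).prod ≠ 1 := by
  classical
  have := hρ.isProC.t2Space
  -- N avoids the images of all letters of the word, which are nontrivial because `ρ` is injective
  -- on each factor.
  obtain ⟨N, hNU, hN⟩ := hρ.isProC.exists_openNormalSubgroup
    (((l.map fun a => ρ a.1 a.2).toFinset : Set H)ᶜ) (by
      refine (Finset.finite_toSet _).isClosed.isOpen_compl.mem_nhds ?_
      simp only [Set.mem_compl_iff, Finset.mem_coe, List.mem_toFinset, List.mem_map, not_exists,
        not_and]
      intro a ha h
      exact h1 a ha (hρ.injective a.1 (hG a.1) (h.trans (map_one _).symm)))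
  have : N.toSubgroup.Normal := N.isNormal'
  have := C.finite_of_mem _ hN
  let π : ∀ i, G i →* H ⧸ N.toSubgroup := fun i =>
    (QuotientGroup.mk' N.toSubgroup).comp (ρ i).toMonoidHom
  have hπ : ∀ a ∈ l, π a.1 a.2 ≠ 1 := by
    intro a ha h
    have h' : ρ a.1 a.2 ∈ N.toSubgroup := (QuotientGroup.eq_one_iff _).mp h
    refine hNU h' ?_
    simp only [Finset.mem_coe, List.mem_toFinset, List.mem_map]
    exact ⟨a, ha, rfl⟩
  obtain ⟨a, ha⟩ := List.exists_mem_of_ne_nil l hne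
  have : Nontrivial (H ⧸ N.toSubgroup) := ⟨⟨_, _, hπ a ha⟩⟩
  obtain ⟨p, hp, hpN⟩ := Nat.exists_prime_and_dvd
    (Finite.one_lt_card (α := H ⧸ N.toSubgroup)).ne'
  have : Fact p.Prime := ⟨hp⟩
  obtain ⟨T, _, _, t, hT, ht⟩ := exists_isPGroup_prod_ne_one.{u} p
    (wreathWord (fun i => π i) l 1)
    (by
      rcases l with _ | ⟨a, l⟩
      · exact (hne rfl).elim
      · simp [wreathWord])
    (wreathWord_isChain (fun i => π i) l hl hπ 1)
  let K := RegularWreathProduct T (H ⧸ N.toSubgroup)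
  let _ : TopologicalSpace K := ⊥
  have : DiscreteTopology K := ⟨rfl⟩
  have hK : IsProC C K :=
    isProC_of_discreteTopology (hC.mem_regularWreathProduct hN hpN hT)
  have hd : DiscreteTopology (H ⧸ N.toSubgroup) := QuotientGroup.discreteTopology N.isOpen'
  let φ : ∀ i, G i →ₜ* K := fun i =>
    { toMonoidHom := ((MulAut.conj (⟨fun q => t (i, q), 1⟩ : K)).toMonoidHom.comp
        RegularWreathProduct.inl).comp (π i)
      continuous_toFun := by
        refine (continuous_of_discreteTopology (f := fun q : H ⧸ N.toSubgroup =>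
          MulAut.conj (⟨fun q => t (i, q), 1⟩ : K) (RegularWreathProduct.inl q))).comp ?_
        exact continuous_quot_mk.comp (ρ i).continuous_toFun }
  obtain ⟨ψ, hψ, -⟩ := hρ.existsUnique_lift K hK φ (ConvergentToOne.of_finite φ)
  intro h
  apply ht
  have h2 := congrArg ψ h
  rw [map_one, map_list_prod, List.map_map] at h2
  have h3 : (ψ ∘ fun a : Σ i, G i => ρ a.1 a.2) = fun a =>
      MulAut.conj (⟨fun q => t (a.1, q), 1⟩ : K) (RegularWreathProduct.inl (π a.1 a.2)) := by
    funext a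
    exact congrArg (fun f : G a.1 →ₜ* K => f a.2) (hψ a.1)
  rw [h3] at h2
  rw [← left_prod_wreath π t l 1, h2]
  rfl

theorem IsFreeProCProduct.lift_injective [∀ i, IsTopologicalGroup (G i)] (hC : C.IsFull)
    (hG : ∀ i, IsProC C (G i)) (hρ : IsFreeProCProduct C ρ) (A : ∀ i, Subgroup (G i)) :
    Function.Injective
      (Monoid.CoprodI.lift fun i => (ρ i).toMonoidHom.comp (A i).subtype) := by
  classical
  rw [injective_iff_map_eq_one]
  intro g hg
  obtain ⟨w, rfl⟩ := (Monoid.CoprodI.Word.equiv (M := fun i => A i)).symm.surjective g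
  change Monoid.CoprodI.lift _ w.prod = 1 at hg
  by_cases hw : w.toList = []
  · change w.prod = 1
    simp [Monoid.CoprodI.Word.prod, hw]
  · refine (hρ.prod_map_ne_one hC hG (w.toList.map fun a => ⟨a.1, a.2.1⟩) (by simpa using hw)
      ?_ ?_ ?_).elim
    · rw [List.isChain_map]
      exact w.chain_ne
    · intro a ha
      obtain ⟨b, hb, rfl⟩ := List.mem_map.mp ha
      have := w.ne_one b hb
      simpa using this
    · rw [← hg, Monoid.CoprodI.Word.prod, map_list_prod, List.map_map, List.map_map]
      congr 1
end FreeProduct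

/-! ### Word lengths -/

namespace SimpleGraph

variable {G : Type*} [Group G] {S : Set G}

/-- Reachability matters: `dist` is 0 between different components, which a homomorphism may join.
-/
theorem Reachable.dist_map_le {V W : Type*} {X : SimpleGraph V} {Y : SimpleGraph W} (f : X →g Y)
    {x y : V} (h : X.Reachable x y) : Y.dist (f x) (f y) ≤ X.dist x y := by
  obtain ⟨p, hp⟩ := h.exists_walk_length_eq_dist
  rw [← hp, ← p.length_map f]
  exact dist_le _

/-- Left translation as a homomorphism of the Cayley graph. -/
def mulCayleyLeft (S : Set G) (a : G) : mulCayley S →g mulCayley S where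
  toFun := fun x => a * x
  map_rel' := fun h => mulCayley_adj_mul_iff_right.mpr h

/-- An injective group homomorphism that respects generators, as a homomorphism of the Cayley
graphs. -/
def mulCayleyMap {H : Type*} [Group H] {Γ : Set G} {S : Set H} (f : G →* H)
    (hf : Function.Injective f) (hS : ∀ x ∈ Γ, f x ∈ S) : mulCayley Γ →g mulCayley S where
  toFun := f
  map_rel' := by
    intro x y h
    rw [mulCayley_adj] at h ⊢
    exact ⟨hf.ne h.1, h.2.imp (fun h => by simpa using hS _ h) (fun h => by simpa using hS _ h)⟩

theorem mulCayley_reachable_mul_left (a : G) {x y : G} (h : (mulCayley S).Reachable x y) :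
    (mulCayley S).Reachable (a * x) (a * y) :=
  h.map (mulCayleyLeft S a)

theorem mulCayley_dist_eq {x y : G} (h : (mulCayley S).Reachable x y) :
    (mulCayley S).dist x y = (mulCayley S).dist 1 (x⁻¹ * y) := by
  have h1 := Reachable.dist_map_le (mulCayleyLeft S x⁻¹) h
  have h2 := Reachable.dist_map_le (mulCayleyLeft S x) (h.map (mulCayleyLeft S x⁻¹))
  simp only [mulCayleyLeft, RelHom.coeFn_mk, inv_mul_cancel, mul_inv_cancel_left,
    mul_one] at h1 h2
  exact le_antisymm h2 h1

theorem mulCayley_reachable_iff {x y : G} :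
    (mulCayley S).Reachable x y ↔ x⁻¹ * y ∈ Subgroup.closure S := by
  constructor
  · rintro ⟨p⟩
    induction p with
    | nil => simp
    | @cons x z y h p ih =>
      have h1 : x⁻¹ * z ∈ Subgroup.closure S := by
        rcases ((mulCayley_adj S _ _).mp h).2 with h | h
        · exact Subgroup.subset_closure h
        · simpa using inv_mem (Subgroup.subset_closure h)
      have := mul_mem h1 ih
      rwa [mul_assoc, mul_inv_cancel_left] at this
  · intro h
    suffices (mulCayley S).Reachable 1 (x⁻¹ * y) by
      simpa using mulCayley_reachable_mul_left x this
    generalize x⁻¹ * y = g at h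
    induction h using Subgroup.closure_induction with
    | mem z hz =>
      -- The graph has no loops, so a generator equal to 1 gives no edge.
      by_cases h1 : 1 = z
      · rw [← h1]
      · exact Adj.reachable ((mulCayley_adj S _ _).mpr ⟨h1, by simp [hz]⟩)
    | one => exact Reachable.refl 1
    | mul a b _ _ ha hb =>
      have := mulCayley_reachable_mul_left a hb
      rw [mul_one] at this
      exact ha.trans this
    | inv a _ ha =>
      have := mulCayley_reachable_mul_left a⁻¹ ha
      rw [mul_one, inv_mul_cancel] at this
      exact this.symm

theorem mulCayley_reachable_one_iff {x : G} :
    (mulCayley S).Reachable 1 x ↔ x ∈ Subgroup.closure S := by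
  rw [mulCayley_reachable_iff, inv_one, one_mul]

theorem mulCayley_dist_one_mul_le {x y : G} (hx : x ∈ Subgroup.closure S)
    (hy : y ∈ Subgroup.closure S) :
    (mulCayley S).dist 1 (x * y) ≤ (mulCayley S).dist 1 x + (mulCayley S).dist 1 y := by
  have h1 := (mulCayley_reachable_one_iff.mpr hx).dist_triangle_left (x * y)
  rwa [mulCayley_dist_eq (x := x) (mulCayley_reachable_iff.mpr (by simpa using hy)),
    inv_mul_cancel_left] at h1

theorem mulCayley_dist_one_inv {x : G} (hx : x ∈ Subgroup.closure S) :
    (mulCayley S).dist 1 x⁻¹ = (mulCayley S).dist 1 x := by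
  have h : (mulCayley S).Reachable x 1 := mulCayley_reachable_iff.mpr (by simpa using hx)
  rw [dist_comm (u := 1) (v := x), mulCayley_dist_eq h, mul_one]

theorem mulCayley_dist_one_le_one {x : G} (hx : x ∈ S) : (mulCayley S).dist 1 x ≤ 1 := by
  by_cases h1 : 1 = x
  · simp [← h1]
  · exact (dist_eq_one_iff_adj.mpr ((mulCayley_adj S _ _).mpr ⟨h1, by simp [hx]⟩)).le

end SimpleGraph

/-- A symmetric subadditive length function on a group. -/
structure IsLengthFunction {M : Type*} [Group M] (N : M → ℕ) : Prop where
  map_one : N 1 = 0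
  map_inv : ∀ a, N a⁻¹ = N a
  map_mul_le : ∀ a b, N (a * b) ≤ N a + N b

/-- The word length on the subgroup generated by `S`. -/
noncomputable def closureLength {G : Type*} [Group G] (S : Set G) (a : Subgroup.closure S) : ℕ :=
  (SimpleGraph.mulCayley S).dist 1 (a : G)

theorem isLengthFunction_closureLength {G : Type*} [Group G] (S : Set G) :
    IsLengthFunction (closureLength S) where
  map_one := by simp [closureLength]
  map_inv a := SimpleGraph.mulCayley_dist_one_inv a.2
  map_mul_le a b := SimpleGraph.mulCayley_dist_one_mul_le a.2 b.2

/-- The Gromov product at `1` for a length function. -/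
noncomputable def lengthGromov {M : Type*} [Group M] (N : M → ℕ) (a b : M) : ℝ :=
  ((N a : ℝ) + N b - N (a⁻¹ * b)) / 2

namespace IsLengthFunction

variable {M : Type*} [Group M] {N : M → ℕ} (hN : IsLengthFunction N)
include hN

theorem lengthGromov_comm (a b : M) : lengthGromov N a b = lengthGromov N b a := by
  have : N (a⁻¹ * b) = N (b⁻¹ * a) := by rw [← hN.map_inv (a⁻¹ * b)]; simp
  rw [lengthGromov, lengthGromov, this, add_comm (N a : ℝ)]

theorem lengthGromov_nonneg (a b : M) : 0 ≤ lengthGromov N a b := by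
  have h := hN.map_mul_le a⁻¹ b
  rw [hN.map_inv] at h
  have h' : (N (a⁻¹ * b) : ℝ) ≤ N a + N b := by exact_mod_cast h
  rw [lengthGromov]
  linarith

theorem lengthGromov_le (a b : M) : lengthGromov N a b ≤ N a := by
  have h := hN.map_mul_le a (a⁻¹ * b)
  rw [mul_inv_cancel_left] at h
  have h' : (N b : ℝ) ≤ N a + N (a⁻¹ * b) := by exact_mod_cast h
  rw [lengthGromov]
  linarith

end IsLengthFunction

/-! ### Lengths in free products -/

namespace Monoid.CoprodI

open Classical in
/-- The Gromov product at `1` of two reduced words. -/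
noncomputable def listGromov {ι : Type*} {M : ι → Type*} [∀ i, Group (M i)] (N : ∀ i, M i → ℕ) :
    List (Σ i, M i) → List (Σ i, M i) → ℝ
  | a :: x, b :: y =>
    if h : a.1 = b.1 then
      if a = b then N b.1 b.2 + listGromov N x y else lengthGromov (N b.1) (h ▸ a.2) b.2
    else 0
  | _, _ => 0

section

variable {ι : Type*} {M : ι → Type*} [∀ i, Group (M i)] {N : ∀ i, M i → ℕ}

@[simp] theorem listGromov_nil_left (y : List (Σ i, M i)) : listGromov N [] y = 0 := by
  rw [listGromov]; simp

@[simp] theorem listGromov_nil_right (x : List (Σ i, M i)) : listGromov N x [] = 0 := by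
  rw [listGromov]; simp

theorem listGromov_cons_of_ne (a b : Σ i, M i) (h : a.1 ≠ b.1) (x y : List (Σ i, M i)) :
    listGromov N (a :: x) (b :: y) = 0 := by
  rw [listGromov, dif_neg h]

theorem listGromov_cons_self (a : Σ i, M i) (x y : List (Σ i, M i)) :
    listGromov N (a :: x) (a :: y) = N a.1 a.2 + listGromov N x y := by
  rw [listGromov, dif_pos rfl, if_pos rfl]

theorem listGromov_cons_of_ne' {i : ι} (a b : M i) (h : a ≠ b) (x y : List (Σ i, M i)) :
    listGromov N (⟨i, a⟩ :: x) (⟨i, b⟩ :: y) = lengthGromov (N i) a b := by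
  rw [listGromov, dif_pos rfl, if_neg (by simpa using h)]

variable (hN : ∀ i, IsLengthFunction (N i))
include hN

theorem listGromov_nonneg (x y : List (Σ i, M i)) : 0 ≤ listGromov N x y := by
  induction x generalizing y with
  | nil => simp
  | cons a x ih =>
    rcases y with _ | ⟨b, y⟩
    · simp
    by_cases h : a.1 = b.1
    · obtain ⟨i, a⟩ := a
      obtain ⟨j, b⟩ := b
      obtain rfl : i = j := h
      by_cases hab : a = b
      · subst hab
        rw [listGromov_cons_self]
        have := ih y
        positivity
      · rw [listGromov_cons_of_ne' a b hab]
        exact (hN i).lengthGromov_nonneg a b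
    · rw [listGromov_cons_of_ne a b h]

/-- Common first letters of all three words are stripped off. The constant δ is really spent only
when the first letters are three distinct elements of one factor; elsewhere the tree structure gives
the bound without loss. -/
theorem min_listGromov_sub_le {δ : ℝ} (hδ : 0 ≤ δ)
    (h : ∀ i (a b c : M i), min (lengthGromov (N i) a c) (lengthGromov (N i) b c) - δ ≤
      lengthGromov (N i) a b) (x y z : List (Σ i, M i)) :
    min (listGromov N x z) (listGromov N y z) - δ ≤ listGromov N x y := by
  induction x generalizing y z with
  | nil =>
    have := min_le_left (listGromov N ([] : List (Σ i, M i)) z) (listGromov N y z)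
    simp only [listGromov_nil_left] at this ⊢
    linarith
  | cons a x ih =>
    have hxy := listGromov_nonneg hN (a :: x) y
    have h1 := min_le_left (listGromov N (a :: x) z) (listGromov N y z)
    have h2 := min_le_right (listGromov N (a :: x) z) (listGromov N y z)
    rcases z with _ | ⟨c, z⟩
    · simp only [listGromov_nil_right] at h1 ⊢
      linarith
    rcases y with _ | ⟨b, y⟩
    · simp only [listGromov_nil_left, listGromov_nil_right] at h2 ⊢
      linarith
    by_cases hac : a.1 = c.1
    swap
    · rw [listGromov_cons_of_ne a c hac] at h1 ⊢
      linarith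
    by_cases hbc : b.1 = c.1
    swap
    · rw [listGromov_cons_of_ne b c hbc] at h2 ⊢
      linarith
    obtain ⟨i, a⟩ := a
    obtain ⟨j, b⟩ := b
    obtain ⟨k, c⟩ := c
    obtain rfl : i = k := hac
    obtain rfl : j = i := hbc
    by_cases hab : a = b
    · subst hab
      by_cases hac : a = c
      · subst hac
        simp only [listGromov_cons_self, min_add_add_left]
        linarith [ih y z]
      · rw [listGromov_cons_of_ne' a c hac] at h1
        rw [listGromov_cons_self] at hxy ⊢
        have := (hN j).lengthGromov_le a c
        have := listGromov_nonneg hN x y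
        rw [listGromov_cons_of_ne' a c hac]
        linarith
    · rw [listGromov_cons_of_ne' a b hab]
      by_cases hac : a = c
      · subst hac
        rw [listGromov_cons_of_ne' b a (Ne.symm hab), (hN j).lengthGromov_comm b a] at h2 ⊢
        linarith
      · rw [listGromov_cons_of_ne' a c hac] at h1 ⊢
        by_cases hbc : b = c
        · subst hbc
          linarith
        · rw [listGromov_cons_of_ne' b c hbc]
          exact h j a b c

end

section Length

variable {ι : Type*} {M : ι → Type*} [∀ i, Group (M i)]

/-- The sum of the lengths of the letters of a word. -/
def listLength (N : ∀ i, M i → ℕ) (l : List (Σ i, M i)) : ℕ :=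
  (l.map fun a => N a.1 a.2).sum

/-- The product in the free product of the letters of a word. -/
def listProd (l : List (Σ i, M i)) : CoprodI M :=
  (l.map fun a => of a.2).prod

/-- A list of letters is reduced. -/
def IsReducedList (l : List (Σ i, M i)) : Prop :=
  l.IsChain (fun a b => a.1 ≠ b.1) ∧ ∀ a ∈ l, a.2 ≠ 1

open Classical in
/-- The reduced word representing an element of the free product. -/
noncomputable def reducedList (g : CoprodI M) : List (Σ i, M i) :=
  (Word.equiv g).toList

/-- The length function on the free product defined by the lengths of the letters of reduced
words. -/
noncomputable def coprodLength (N : ∀ i, M i → ℕ) (g : CoprodI M) : ℕ :=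
  listLength N (reducedList g)

theorem listProd_append (l l' : List (Σ i, M i)) :
    listProd (l ++ l') = listProd l * listProd l' := by
  simp [listProd]

theorem listProd_cons (a : Σ i, M i) (l : List (Σ i, M i)) :
    listProd (a :: l) = of a.2 * listProd l := by
  simp [listProd]

omit [∀ i, Group (M i)] in
theorem listLength_append (N : ∀ i, M i → ℕ) (l l' : List (Σ i, M i)) :
    listLength N (l ++ l') = listLength N l + listLength N l' := by
  simp [listLength]

omit [∀ i, Group (M i)] in
theorem listLength_cons (N : ∀ i, M i → ℕ) (a : Σ i, M i) (l : List (Σ i, M i)) :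
    listLength N (a :: l) = N a.1 a.2 + listLength N l := by
  simp [listLength]

theorem isReducedList_reducedList (g : CoprodI M) : IsReducedList (reducedList g) :=
  ⟨Word.chain_ne _, fun a ha => Word.ne_one _ a ha⟩

theorem listProd_reducedList (g : CoprodI M) : listProd (reducedList g) = g := by
  classical
  exact Word.equiv.left_inv g

theorem reducedList_listProd {l : List (Σ i, M i)} (hl : IsReducedList l) :
    reducedList (listProd l) = l := by
  classical
  exact congrArg Word.toList (Word.equiv.right_inv (⟨l, hl.2, hl.1⟩ : Word M))

theorem coprodLength_listProd (N : ∀ i, M i → ℕ) {l : List (Σ i, M i)} (hl : IsReducedList l) :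
    coprodLength N (listProd l) = listLength N l := by
  rw [coprodLength, reducedList_listProd hl]

/-- The word of the inverses in the opposite order. -/
def invList (l : List (Σ i, M i)) : List (Σ i, M i) :=
  (l.map fun a => (⟨a.1, a.2⁻¹⟩ : Σ i, M i)).reverse

theorem listProd_invList (l : List (Σ i, M i)) : listProd (invList l) = (listProd l)⁻¹ := by
  induction l with
  | nil => simp [invList, listProd]
  | cons a l ih =>
    have : invList (a :: l) = invList l ++ [⟨a.1, a.2⁻¹⟩] := by simp [invList]
    rw [this, listProd_append, ih, listProd_cons a l, mul_inv_rev]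
    simp [listProd]

theorem listLength_invList {N : ∀ i, M i → ℕ} (hN : ∀ i, IsLengthFunction (N i))
    (l : List (Σ i, M i)) : listLength N (invList l) = listLength N l := by
  rw [listLength, invList, List.map_reverse, List.sum_reverse, List.map_map, listLength]
  congr 1
  exact List.map_congr_left fun a _ => (hN a.1).map_inv a.2

theorem IsReducedList.tail {a : Σ i, M i} {l : List (Σ i, M i)} (h : IsReducedList (a :: l)) :
    IsReducedList l :=
  ⟨h.1.tail, fun b hb => h.2 b (by simp [hb])⟩

theorem IsReducedList.invList {l : List (Σ i, M i)} (h : IsReducedList l) :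
    IsReducedList (invList l) := by
  refine ⟨?_, ?_⟩
  · rw [Monoid.CoprodI.invList, List.isChain_reverse, List.isChain_map]
    exact h.1.imp fun a b hab => Ne.symm hab
  · intro a ha
    simp only [Monoid.CoprodI.invList, List.mem_reverse, List.mem_map] at ha
    obtain ⟨b, hb, rfl⟩ := ha
    simpa using h.2 b hb

theorem IsReducedList.append {l l' : List (Σ i, M i)} (h : IsReducedList l)
    (h' : IsReducedList l') (hne : ∀ a ∈ l.getLast?, ∀ b ∈ l'.head?, a.1 ≠ b.1) :
    IsReducedList (l ++ l') := by
  refine ⟨List.isChain_append.mpr ⟨h.1, h'.1, hne⟩, fun a ha => ?_⟩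
  rcases List.mem_append.mp ha with ha | ha
  · exact h.2 a ha
  · exact h'.2 a ha

theorem IsReducedList.replace {i : ι} {a : M i} {l : List (Σ i, M i)}
    (h : IsReducedList (⟨i, a⟩ :: l)) {b : M i} (hb : b ≠ 1) : IsReducedList (⟨i, b⟩ :: l) := by
  refine ⟨?_, ?_⟩
  · rw [List.isChain_cons]
    exact List.isChain_cons.mp h.1
  · intro c hc
    rcases List.mem_cons.mp hc with rfl | hc
    · exact hb
    · exact h.2 c (by simp [hc])

theorem head_invList (l : List (Σ i, M i)) (a : Σ i, M i) (ha : a ∈ (invList l).getLast?) :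
    ∃ b ∈ l.head?, b.1 = a.1 := by
  rcases l with _ | ⟨b, l⟩
  · simp [invList] at ha
  · simp only [invList, List.map_cons, List.reverse_cons, List.getLast?_append,
      List.getLast?_singleton, Option.some_or, Option.mem_some] at ha
    exact ⟨b, by simp, by rw [← ha]⟩

/-- After the common prefix cancels in x⁻¹y, the first differing letters a, b either merge into a⁻¹b
≠ 1 or lie in different factors. The resulting word is reduced, so its length can be read off. -/
theorem two_mul_listGromov {N : ∀ i, M i → ℕ} (hN : ∀ i, IsLengthFunction (N i))
    {x y : List (Σ i, M i)} (hx : IsReducedList x) (hy : IsReducedList y) :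
    2 * listGromov N x y = listLength N x + listLength N y -
      coprodLength N ((listProd x)⁻¹ * listProd y) := by
  induction x generalizing y with
  | nil =>
    have : (listProd ([] : List (Σ i, M i)))⁻¹ * listProd y = listProd y := by simp [listProd]
    rw [this, coprodLength_listProd N hy]
    simp [listLength]
  | cons a x ih =>
    rcases y with _ | ⟨b, y⟩
    · have : (listProd (a :: x))⁻¹ * listProd ([] : List (Σ i, M i)) =
          listProd (invList (a :: x)) := by rw [listProd_invList]; simp [listProd]
      rw [this, coprodLength_listProd N hx.invList, listLength_invList hN]
      simp [listLength]
    by_cases hab : a.1 = b.1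
    · obtain ⟨i, a⟩ := a
      obtain ⟨j, b⟩ := b
      obtain rfl : i = j := hab
      by_cases hab : a = b
      · subst hab
        have h := ih hx.tail hy.tail
        have h2 : (listProd (⟨i, a⟩ :: x))⁻¹ * listProd (⟨i, a⟩ :: y) =
            (listProd x)⁻¹ * listProd y := by
          rw [listProd_cons, listProd_cons]; group
        rw [h2, listGromov_cons_self, mul_add, h, listLength_cons, listLength_cons]
        push_cast
        ring
      · have hr : IsReducedList (invList x ++ ⟨i, a⁻¹ * b⟩ :: y) := by
          refine hx.tail.invList.append (hy.replace fun h => hab (inv_mul_eq_one.mp h)) ?_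
          intro c hc d hd
          obtain ⟨e, he, hec⟩ := head_invList x c hc
          have := (List.isChain_cons.mp hx.1).1 e he
          rw [List.head?_cons, Option.mem_some] at hd
          rw [← hd, ← hec]
          exact this.symm
        have h2 : (listProd (⟨i, a⟩ :: x))⁻¹ * listProd (⟨i, b⟩ :: y) =
            listProd (invList x ++ ⟨i, a⁻¹ * b⟩ :: y) := by
          rw [listProd_append, listProd_invList, listProd_cons, listProd_cons, listProd_cons]
          simp [mul_assoc]
        rw [h2, coprodLength_listProd N hr, listGromov_cons_of_ne' a b hab, lengthGromov,
          listLength_append, listLength_invList hN]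
        simp only [listLength_cons]
        push_cast
        ring
    · have hr : IsReducedList (invList (a :: x) ++ b :: y) := by
        refine hx.invList.append hy ?_
        intro c hc d hd
        obtain ⟨e, he, hec⟩ := head_invList _ c hc
        rw [List.head?_cons, Option.mem_some] at he hd
        rw [← hec, ← he, ← hd]
        exact hab
      rw [← listProd_invList, ← listProd_append, coprodLength_listProd N hr,
        listGromov_cons_of_ne a b hab, listLength_append, listLength_invList hN]
      push_cast
      ring

/-- Split g into a head in the factor i, possibly 1, and a tail not starting in that factor.
Multiplication by a changes only the head, so subadditivity in M i suffices. -/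
theorem coprodLength_of_mul_le {N : ∀ i, M i → ℕ} (hN : ∀ i, IsLengthFunction (N i)) {i : ι}
    (a : M i) (g : CoprodI M) : coprodLength N (of a * g) ≤ N i a + coprodLength N g := by
  classical
  have key : ∀ p : Word.Pair M i, listLength N (Word.rcons p).toList =
      N i p.head + listLength N p.tail.toList := by
    intro p
    rw [Word.rcons]
    split_ifs with h
    · rw [h, (hN i).map_one, zero_add]
    · rw [Word.cons_toList, listLength_cons]
  let w := Word.equiv g
  have h1 : reducedList (of a * g) = (of a • w).toList := by
    have : listProd (of a • w).toList = of a * g := by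
      have := Word.prod_smul (of a) w
      rw [show w.prod = g from Word.equiv.left_inv g] at this
      exact this
    rw [← this]
    exact reducedList_listProd ⟨Word.chain_ne _, fun b hb => Word.ne_one _ b hb⟩
  have h2 : reducedList g = (Word.rcons (Word.equivPair i w)).toList := by
    rw [← Word.equivPair_symm, Equiv.symm_apply_apply]
    rfl
  rw [coprodLength, coprodLength, h1, h2, Word.of_smul_def, key, key, ← add_assoc]
  exact Nat.add_le_add_right ((hN i).map_mul_le _ _) _

end Length

end Monoid.CoprodI

/-! ### The Cayley graph of a free product -/

section CayleyFreeProduct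

open SimpleGraph Monoid.CoprodI

variable {ι : Type*} {G : ι → Type*} [∀ i, Group (G i)] {H : Type*} [Group H]

theorem dist_lift_le (Γ : ∀ i, Set (G i)) (ρ : ∀ i, G i →* H)
    (hρ : ∀ i, Function.Injective (ρ i)) (g : Monoid.CoprodI fun i => Subgroup.closure (Γ i)) :
    (mulCayley (⋃ i, ρ i '' Γ i)).dist 1
        (Monoid.CoprodI.lift (fun i => (ρ i).comp (Subgroup.closure (Γ i)).subtype) g) ≤
      coprodLength (fun i => closureLength (Γ i)) g := by
  have hmem : ∀ i, ∀ a : Subgroup.closure (Γ i),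
      ρ i a ∈ Subgroup.closure (⋃ i, ρ i '' Γ i) := by
    intro i a
    have h := Subgroup.mem_map_of_mem (ρ i) a.2
    rw [MonoidHom.map_closure] at h
    exact Subgroup.closure_mono (Set.subset_iUnion (fun i => ρ i '' Γ i) i) h
  have hle : ∀ i, ∀ a : Subgroup.closure (Γ i), (mulCayley (⋃ i, ρ i '' Γ i)).dist 1 (ρ i a) ≤
      (mulCayley (Γ i)).dist 1 (a : G i) := by
    intro i a
    have h := Reachable.dist_map_le (mulCayleyMap (S := ⋃ i, ρ i '' Γ i) (ρ i) (hρ i)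
      fun x hx => Set.mem_iUnion.mpr ⟨i, x, hx, rfl⟩) (mulCayley_reachable_one_iff.mpr a.2)
    simpa only [mulCayleyMap, RelHom.coeFn_mk, map_one] using h
  -- Membership in the closure is carried along because subadditivity of the distance from 1 is
  -- available only there.
  suffices ∀ l : List (Σ i, Subgroup.closure (Γ i)),
      Monoid.CoprodI.lift (fun i => (ρ i).comp (Subgroup.closure (Γ i)).subtype) (listProd l) ∈
        Subgroup.closure (⋃ i, ρ i '' Γ i) ∧
      (mulCayley (⋃ i, ρ i '' Γ i)).dist 1
        (Monoid.CoprodI.lift (fun i => (ρ i).comp (Subgroup.closure (Γ i)).subtype)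
          (listProd l)) ≤ listLength (fun i => closureLength (Γ i)) l by
    have h := (this (reducedList g)).2
    rwa [listProd_reducedList] at h
  intro l
  induction l with
  | nil => simp [listProd]
  | cons a l ih =>
    rw [listProd_cons, listLength_cons, map_mul, Monoid.CoprodI.lift_of]
    exact ⟨mul_mem (hmem a.1 a.2) ih.1, (mulCayley_dist_one_mul_le (hmem a.1 a.2) ih.1).trans
      (Nat.add_le_add (hle a.1 a.2) ih.2)⟩

/-- Along a geodesic each edge changes the free product length by at most 1; injectivity of the lift
identifies the element reached at the end with 1. -/
theorem coprodLength_le_dist_lift (Γ : ∀ i, Set (G i)) (ρ : ∀ i, G i →* H)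
    (hinj : Function.Injective
      (Monoid.CoprodI.lift fun i => (ρ i).comp (Subgroup.closure (Γ i)).subtype))
    (g : Monoid.CoprodI fun i => Subgroup.closure (Γ i))
    (hg : Monoid.CoprodI.lift (fun i => (ρ i).comp (Subgroup.closure (Γ i)).subtype) g ∈
      Subgroup.closure (⋃ i, ρ i '' Γ i)) :
    coprodLength (fun i => closureLength (Γ i)) g ≤
      (mulCayley (⋃ i, ρ i '' Γ i)).dist 1
        (Monoid.CoprodI.lift (fun i => (ρ i).comp (Subgroup.closure (Γ i)).subtype) g) := by
  set j := Monoid.CoprodI.lift (fun i => (ρ i).comp (Subgroup.closure (Γ i)).subtype)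
  have hN := fun i => isLengthFunction_closureLength (Γ i)
  have step : ∀ (i : ι) (s : G i) (_ : s ∈ Γ i) (ε : Bool)
      (g : Monoid.CoprodI fun i => Subgroup.closure (Γ i)),
      ∃ g', j g' = (bif ε then ρ i s else (ρ i s)⁻¹) * j g ∧
        coprodLength (fun i => closureLength (Γ i)) g ≤
          1 + coprodLength (fun i => closureLength (Γ i)) g' := by
    intro i s hs ε g
    let σ : Subgroup.closure (Γ i) := ⟨s, Subgroup.subset_closure hs⟩
    have hσ : (mulCayley (Γ i)).dist 1 (σ : G i) ≤ 1 := mulCayley_dist_one_le_one hs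
    cases ε
    · refine ⟨of (M := fun i => Subgroup.closure (Γ i)) σ⁻¹ * g, by rw [map_mul, Monoid.CoprodI.lift_of]; simp [σ], ?_⟩
      have h := coprodLength_of_mul_le hN σ (of (M := fun i => Subgroup.closure (Γ i)) σ⁻¹ * g)
      rw [← mul_assoc, ← map_mul, mul_inv_cancel, map_one, one_mul] at h
      exact h.trans (Nat.add_le_add_right hσ _)
    · refine ⟨of (M := fun i => Subgroup.closure (Γ i)) σ * g, by rw [map_mul, Monoid.CoprodI.lift_of]; simp [σ], ?_⟩
      have h := coprodLength_of_mul_le hN σ⁻¹ (of (M := fun i => Subgroup.closure (Γ i)) σ * g)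
      rw [← mul_assoc, ← map_mul, inv_mul_cancel, map_one, one_mul] at h
      refine h.trans (Nat.add_le_add_right ?_ _)
      exact ((hN i).map_inv σ).trans_le hσ
  -- Tracking x⁻¹ instead of x turns the right multiplications along edges into left ones, as
  -- `coprodLength_of_mul_le` requires.
  have walk : ∀ (x y : H) (p : (mulCayley (⋃ i, ρ i '' Γ i)).Walk x y)
      (g : Monoid.CoprodI fun i => Subgroup.closure (Γ i)), y = 1 → j g = x⁻¹ →
      coprodLength (fun i => closureLength (Γ i)) g ≤ p.length := by
    intro x y p
    induction p with
    | nil =>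
      rintro g rfl hg
      have : g = listProd [] := hinj (by rw [hg]; simp [listProd])
      rw [this, coprodLength_listProd _ ⟨List.isChain_nil, by simp⟩]
      simp [listLength]
    | @cons x z y h p ih =>
      rintro g rfl hg
      obtain ⟨-, h⟩ := (mulCayley_adj _ _ _).mp h
      rw [SimpleGraph.Walk.length_cons, add_comm]
      rcases h with h | h
      · obtain ⟨i, s, hs, hsx⟩ := Set.mem_iUnion.mp h
        obtain ⟨g', h1, h2⟩ := step i s hs false g
        refine h2.trans (Nat.add_le_add_left (ih g' rfl ?_) 1)
        rw [h1, hg, cond_false, hsx]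
        group
      · obtain ⟨i, s, hs, hsx⟩ := Set.mem_iUnion.mp h
        obtain ⟨g', h1, h2⟩ := step i s hs true g
        refine h2.trans (Nat.add_le_add_left (ih g' rfl ?_) 1)
        rw [h1, hg, cond_true, hsx]
        group
  have hr : (mulCayley (⋃ i, ρ i '' Γ i)).Reachable (j g)⁻¹ 1 :=
    mulCayley_reachable_iff.mpr (by simpa using hg)
  obtain ⟨p, hp⟩ := hr.exists_walk_length_eq_dist
  rw [mulCayley_dist_eq hr, inv_inv, mul_one] at hp
  rw [← hp]
  exact walk _ _ p g rfl (inv_inv _).symm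

theorem HasHyperbolicCayleyGraph.min_lengthGromov_sub_le {G : Type u} [Group G] {Γ : Set G} {δ : ℝ}
    (h : ∀ c : (mulCayley Γ).ConnectedComponent,
      IsDeltaHyperbolicOn (fun x y => ((mulCayley Γ).dist x y : ℝ)) c.supp δ)
    (a b c : Subgroup.closure Γ) :
    min (lengthGromov (closureLength Γ) a c)
      (lengthGromov (closureLength Γ) b c) - δ ≤
      lengthGromov (closureLength Γ) a b := by
  have hmem : ∀ a : Subgroup.closure Γ,
      (a : G) ∈ ((mulCayley Γ).connectedComponentMk 1).supp := fun a =>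
    ConnectedComponent.eq.mpr (mulCayley_reachable_one_iff.mpr a.2).symm
  have hgr : ∀ a b : Subgroup.closure Γ,
      gromovProduct (fun x y => ((mulCayley Γ).dist x y : ℝ)) (1 : G) a b =
      lengthGromov (closureLength Γ) a b := by
    intro a b
    rw [gromovProduct, lengthGromov, dist_comm (u := (a : G)) (v := 1),
      dist_comm (u := (b : G)) (v := 1), mulCayley_dist_eq (x := (a : G)) (y := b)
        (mulCayley_reachable_iff.mpr (mul_mem (inv_mem a.2) b.2))]
    rfl
  have := h _ 1 (hmem 1) a (hmem a) b (hmem b) c (hmem c)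
  rwa [hgr, hgr, hgr] at this

theorem hasHyperbolicCayleyGraph_iUnion {ι : Type*} [Finite ι] {G : ι → Type u}
    [∀ i, Group (G i)] {H : Type u} [Group H] (Γ : ∀ i, Set (G i)) (ρ : ∀ i, G i →* H)
    (hρ : ∀ i, Function.Injective (ρ i))
    (hinj : Function.Injective
      (Monoid.CoprodI.lift fun i => (ρ i).comp (Subgroup.closure (Γ i)).subtype))
    (hΓ : ∀ i, HasHyperbolicCayleyGraph (G i) (Γ i)) :
    HasHyperbolicCayleyGraph H (⋃ i, ρ i '' Γ i) := by
  choose δ hδ0 hδ using hΓ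
  obtain ⟨D, hD⟩ := Finite.bddAbove_range δ
  -- For an empty index set the bound D could be negative.
  refine ⟨max D 0, le_max_right _ _, ?_⟩
  set j := Monoid.CoprodI.lift (fun i => (ρ i).comp (Subgroup.closure (Γ i)).subtype) with hj
  set S := ⋃ i, ρ i '' Γ i with hS
  let N : ∀ i, Subgroup.closure (Γ i) → ℕ := fun i => closureLength (Γ i)
  have hN : ∀ i, IsLengthFunction (N i) := fun i => isLengthFunction_closureLength (Γ i)
  have hsurj : Subgroup.closure S ≤ j.range := by
    rw [Subgroup.closure_le]
    intro x hx
    obtain ⟨i, s, hs, rfl⟩ := Set.mem_iUnion.mp hx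
    exact ⟨of (M := fun i => Subgroup.closure (Γ i)) (i := i) ⟨s, Subgroup.subset_closure hs⟩, by
      rw [hj, Monoid.CoprodI.lift_of]; rfl⟩
  have hdist : ∀ g, j g ∈ Subgroup.closure S → (mulCayley S).dist 1 (j g) = coprodLength N g :=
    fun g hg => le_antisymm (dist_lift_le Γ ρ hρ g) (coprodLength_le_dist_lift Γ ρ hinj g hg)
  intro c x₀ hx₀ x hx y hy z hz
  have hreach : ∀ x ∈ c.supp, ∀ y ∈ c.supp, (mulCayley S).Reachable x y := fun x hx y hy =>
    ConnectedComponent.eq.mp (hx.trans hy.symm)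
  -- Left translation moves the base point to 1, and `j` carries the free product length to the word
  -- metric.
  have hgr : ∀ x ∈ c.supp, ∀ y ∈ c.supp, ∀ g h, j g = x₀⁻¹ * x → j h = x₀⁻¹ * y →
      gromovProduct (fun x y => ((mulCayley S).dist x y : ℝ)) x₀ x y =
        listGromov N (reducedList g) (reducedList h) := by
    intro x hx y hy g h hg hh
    have h1 : j (g⁻¹ * h) = x⁻¹ * y := by rw [map_mul, map_inv, hg, hh]; group
    have h2 := two_mul_listGromov hN (isReducedList_reducedList g) (isReducedList_reducedList h)
    rw [listProd_reducedList, listProd_reducedList] at h2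
    have h3 := mulCayley_reachable_iff.mp (hreach x₀ hx₀ x hx)
    have h4 := mulCayley_reachable_iff.mp (hreach x₀ hx₀ y hy)
    have h5 := mulCayley_reachable_iff.mp (hreach x hx y hy)
    rw [gromovProduct, dist_comm (u := x), dist_comm (u := y) (v := x₀),
      mulCayley_dist_eq (hreach x₀ hx₀ x hx), mulCayley_dist_eq (hreach x₀ hx₀ y hy),
      mulCayley_dist_eq (hreach x hx y hy), ← hg, ← hh, ← h1, hdist g (hg ▸ h3),
      hdist h (hh ▸ h4), hdist _ (h1 ▸ h5)]
    change _ = (listLength N (reducedList g) : ℝ) + listLength N (reducedList h) - _ at h2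
    simp only [coprodLength] at h2 ⊢
    linarith
  obtain ⟨a, ha⟩ := hsurj (mulCayley_reachable_iff.mp (hreach x₀ hx₀ x hx))
  obtain ⟨b, hb⟩ := hsurj (mulCayley_reachable_iff.mp (hreach x₀ hx₀ y hy))
  obtain ⟨e, he⟩ := hsurj (mulCayley_reachable_iff.mp (hreach x₀ hx₀ z hz))
  rw [hgr x hx z hz a e ha he, hgr y hy z hz b e hb he, hgr x hx y hy a b ha hb]
  refine min_listGromov_sub_le hN (le_max_right _ _) (fun i a b c => ?_) _ _ _
  have h1 := HasHyperbolicCayleyGraph.min_lengthGromov_sub_le (hδ i) a b c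
  have h2 : δ i ≤ max D 0 := (hD (Set.mem_range_self i)).trans (le_max_left _ _)
  linarith

end CayleyFreeProduct

theorem mainTheorem1 (C : FiniteGroupClass.{u}) (hC : C.IsFull)
    {ι : Type v} [Finite ι] (G : ι → Type u) [∀ i, Group (G i)] [∀ i, TopologicalSpace (G i)]
    [∀ i, IsTopologicalGroup (G i)] (hG : ∀ i, IsHyperbolicProC C (G i))
    (H : Type u) [Group H] [TopologicalSpace H] [IsTopologicalGroup H]
    (ρ : ∀ i, G i →ₜ* H) (hρ : IsFreeProCProduct C ρ) :
    IsHyperbolicProC C H := by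
  choose hpro Γ hfin hgen hhyp using hG
  refine ⟨hρ.isProC, ⋃ i, (ρ i).toMonoidHom '' Γ i,
    Set.finite_iUnion fun i => (hfin i).image _, ?_, ?_⟩
  · refine hρ.eq_top_of_isClosed hC _ (Subgroup.isClosed_topologicalClosure _) fun i x => ?_
    have hx : x ∈ (Subgroup.closure (Γ i)).topologicalClosure := by rw [hgen i]; trivial
    -- By continuity of `ρ i` the preimage of the closed subgroup is closed, and it contains the
    -- dense subgroup ⟨Γ i⟩.
    have hle : (Subgroup.closure (Γ i)).topologicalClosure ≤
        ((Subgroup.closure (⋃ i, (ρ i).toMonoidHom '' Γ i)).topologicalClosure).comap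
          (ρ i).toMonoidHom := by
      refine Subgroup.topologicalClosure_minimal _ ?_
        ((Subgroup.isClosed_topologicalClosure _).preimage (ρ i).continuous_toFun)
      rw [Subgroup.closure_le]
      intro s hs
      exact Subgroup.le_topologicalClosure _
        (Subgroup.subset_closure (Set.mem_iUnion.mpr ⟨i, s, hs, rfl⟩))
    exact hle hx
  · exact hasHyperbolicCayleyGraph_iUnion Γ (fun i => (ρ i).toMonoidHom)
      (fun i => hρ.injective i (hpro i)) (hρ.lift_injective hC hpro _) hhyp
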